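/- Let $G$ be a (possibly disconnected) planar subdivision, given by a finite plane straight-line graph with $n$ vertices, all of them in $[0,1]^2$; its faces are the connected components of the complement of its vertices and edges. Let $D$ be a probability measure on $\mathbb R^2$ with $D([0,1]^2)=1$. For a finite collection $P$ of sets that partitions $\mathbb R^2$ up to $D$-null sets, put $H(P)=\sum_{t\in P}D(t)\log_2(1/D(t))$, with the convention $0\log_2(1/0)=0$. A *partition tree* $T$ for $(G,D)$ with parameters $r\in\mathbb N$, $\alpha>0$ (and constant $c$) is built as follows. The root (depth $0$) is a closed square that carries all of $D$; it is always split. When a cell $R$ is split, one takes closed triangles $\Delta_1,\dots,\Delta_r$ which cover almost everything for the conditional distribution $D_{|R}$, such that $D_{|R}(\Delta_i\setminus\bigcup_{j<i}\Delta_j)\le 3/r$ for every $i$ and such that every line meets the interiors of at most $c\sqrt r$ of them. Then $R$ is divided into at most $c\,r^2$ closed triangles with disjoint interiors that refine the arrangement of $\Delta_1,\dots,\Delta_r$ inside $R$ (no interior of a piece meets the boundary of a $\Delta_i$), in such a way that every line meets the interiors of at most $c\sqrt r\log r$ of the pieces; the pieces become the children of $R$. (If $D(R)=0$, the conditions on $D_{|R}$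 are void.) A child whose interior is contained in a single face of $G$ is a (terminal) leaf; any other child of depth greater than $\lfloor\alpha\log_r n\rfloor$ is a (non-terminal) leaf; every other child is split in the same way. Let $L$ be the set of leaves of $T$. A *Steiner triangulation* of $G$ is a finite set $\Delta^*$ of closed triangles with pairwise disjoint interiors that cover $[0,1]^2$, the interior of each triangle being contained in a face of $G$; the triangles may have vertices that are not vertices of $G$ and need not fit together face to face. Write $H^*=H(\Delta^*)$. **Claim.** $H^*=\Omega(H(L)-1)$, in the sense that $H^*$ is bounded below by a constant positive multiple of $H(L)$ minus a constant. Precisely: for every $c>0$ there is an $r_0$ such that for every integer $r\ge r_0$ there are constants $\kappa>0$ and $b$ (depending only on $c$ and $r$) such that, for every $\alpha>0$, all $G$ and $D$ as above, every partition tree $T$ for $(G,D)$ with parameters $r,\alpha$ and constant $c$, and every Steiner triangulation $\Delta^*$ of $G$, if the boundaries of the leaves of $T$ and of the triangles of $\Delta^*$ have $D$-measure zero (so that $L$ and $\Delta^*$ are partitions up to null sets), then $$H(\Delta^*)\ \ge\ \kappa\,H(L)-b .$$ -/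

import Mathlib

open MeasureTheory

/-- The Euclidean plane. -/
abbrev Plane : Type := EuclideanSpace ℝ (Fin 2)

/-- The unit square `[0,1]²`. -/
def unitSquare : Set Plane := {p | ∀ i, p i ∈ Set.Icc (0 : ℝ) 1}

/-- `ℓ` is a line. -/
def IsLine (ℓ : AffineSubspace ℝ Plane) : Prop := Module.finrank ℝ ℓ.direction = 1

/-- `S` is a closed (non-degenerate) triangle. -/
def IsTriangle (S : Set Plane) : Prop :=
  ∃ x y z : Plane, AffineIndependent ℝ ![x, y, z] ∧ S = convexHull ℝ {x, y, z}

/-- `Q` is a closed square (of any position, orientation and positive side length). -/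
def IsClosedSquare (Q : Set Plane) : Prop :=
  ∃ (s : ℝ) (e : Plane ≃ᵢ Plane), 0 < s ∧ Q = e '' {p | ∀ i, p i ∈ Set.Icc (0 : ℝ) s}

/-- The members of the family are closed triangles with pairwise disjoint interiors. -/
def IsTriangleTiling {ι : Type} (t : ι → Set Plane) : Prop :=
  (∀ i, IsTriangle (t i)) ∧ ∀ i j, i ≠ j → Disjoint (interior (t i)) (interior (t j))

/-- A (possibly disconnected) planar subdivision, given by a finite plane straight-line graph. -/
structure PlanarSubdivision where
  /-- the vertices -/
  vertices : Finset Plane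
  /-- the edges; every edge is drawn as the segment between its endpoints -/
  graph : SimpleGraph vertices
  /-- an edge contains no vertex besides its endpoints -/
  vertex_on_edge : ∀ u v w : vertices, graph.Adj u v →
    (w : Plane) ∈ segment ℝ (u : Plane) (v : Plane) → w = u ∨ w = v
  /-- distinct edges meet in common endpoints only -/
  noncrossing : ∀ u v w x : vertices, graph.Adj u v → graph.Adj w x → s(u, v) ≠ s(w, x) →
    segment ℝ (u : Plane) (v : Plane) ∩ segment ℝ (w : Plane) (x : Plane) ⊆
      ({(u : Plane), (v : Plane)} ∩ {(w : Plane), (x : Plane)} : Set Plane)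

namespace PlanarSubdivision

/-- The union of all vertices and edges. -/
def skeleton (G : PlanarSubdivision) : Set Plane :=
  (G.vertices : Set Plane) ∪
    {p | ∃ u v : G.vertices, G.graph.Adj u v ∧ p ∈ segment ℝ (u : Plane) (v : Plane)}

/-- The faces are the connected components of the complement of the vertices and edges. -/
def IsFace (G : PlanarSubdivision) (f : Set Plane) : Prop :=
  ∃ p ∈ G.skeletonᶜ, f = connectedComponentIn G.skeletonᶜ p

/-- The interior of `F` is contained in a single face of `G`. -/
def InSingleFace (G : PlanarSubdivision) (F : Set Plane) : Prop :=
  ∃ f, G.IsFace f ∧ interior F ⊆ f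

/-- `Δ` is a Steiner triangulation of `G` (over the unit square): a finite set of closed
triangles with pairwise disjoint interiors that cover the unit square, the interior of each of
them being contained in a face of `G`. The triangles are free to have vertices that are not
vertices of `G`; they may, but need not, fit together face to face. -/
def IsSteinerTriangulation (G : PlanarSubdivision) (Δ : Finset (Set Plane)) : Prop :=
  IsTriangleTiling (fun t : Δ => (t : Set Plane)) ∧
    unitSquare ⊆ (⋃ t ∈ Δ, t) ∧ ∀ t ∈ Δ, G.InSingleFace t

end PlanarSubdivision

/-- The entropy `∑ Pr(t) log (1 / Pr(t))` (logarithm to base `2`) of a finite collection of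
sets, which is meant to be a partition up to null sets. -/
noncomputable def partitionEntropy (D : Measure Plane) (P : Finset (Set Plane)) : ℝ :=
  ∑ t ∈ P, D.real t * Real.logb 2 (1 / D.real t)

/-- A simplicial partition of size `r` for the measure `μ`, with crossing constant `c`: closed
triangles `Δ₁, …, Δᵣ` that cover `μ`-almost everything, such that each of them contributes at
most `3 / r` to the measure of the union of the first ones, and such that every line meets the
interiors of at most `c √r` of them. -/
structure IsSimplicialPartition (μ : Measure Plane) (r : ℕ) (c : ℝ)
    (Δ : Fin r → Set Plane) : Prop where
  triangle : ∀ i, IsTriangle (Δ i)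
  cover : μ (⋃ i, Δ i)ᶜ = 0
  small : ∀ i, μ.real (Δ i \ ⋃ j, ⋃ (_ : j < i), Δ j) ≤ 3 / r
  crossing : ∀ ℓ : AffineSubspace ℝ Plane, IsLine ℓ →
    (({i | ((ℓ : Set Plane) ∩ interior (Δ i)).Nonempty} : Set (Fin r)).ncard : ℝ) ≤ c * √r

/-- One step of the construction of a partition tree: the cell `R` is split into the faces
`A₁, …, Aₘ` of a (Steiner) triangulation, inside `R`, of the arrangement of the triangles of a
simplicial partition for the distribution `D` conditioned on `R`. There are at most `c r²` faces,
and every line meets the interiors of at most `c √r log r` of them. -/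
structure IsCellSplitting (D : Measure Plane) (r : ℕ) (c : ℝ) (R : Set Plane) (m : ℕ)
    (A : Fin m → Set Plane) : Prop where
  tiling : IsTriangleTiling A
  union_eq : (⋃ i, A i) = R
  refines : ∃ Δ : Fin r → Set Plane, IsSimplicialPartition (ProbabilityTheory.cond D R) r c Δ ∧
    ∀ i j, Disjoint (interior (A i)) (frontier (Δ j))
  card_le : (m : ℝ) ≤ c * (r : ℝ) ^ 2
  crossing : ∀ ℓ : AffineSubspace ℝ Plane, IsLine ℓ →
    (({i | ((ℓ : Set Plane) ∩ interior (A i)).Nonempty} : Set (Fin m)).ncard : ℝ) ≤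
      c * √r * Real.log r

/-- Finite rooted trees whose nodes are labelled with regions (cells) of the plane. -/
inductive CellTree : Type
  | leaf (F : Set Plane) : CellTree
  | node (R : Set Plane) (m : ℕ) (child : Fin m → CellTree) : CellTree

namespace CellTree

/-- The cell at the root. -/
def cell : CellTree → Set Plane
  | leaf F => F
  | node R _ _ => R

open Classical in
/-- The set of (the cells of) the leaves. -/
noncomputable def leaves : CellTree → Finset (Set Plane)
  | leaf F => {F}
  | node _ _ child => Finset.univ.biUnion fun i => (child i).leaves

/-- The tree is a possible outcome of the recursive construction for a cell at depth `d ≥ 1`,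
where `M` is the depth threshold. A cell whose interior lies in a single face of `G` is a
(terminal) leaf; a cell of depth greater than `M` is a (non-terminal) leaf; every other cell is
split, and the construction continues with the pieces. -/
def IsSubtree (G : PlanarSubdivision) (D : Measure Plane) (r : ℕ) (c : ℝ) (M : ℕ) :
    ℕ → CellTree → Prop
  | d, leaf F => G.InSingleFace F ∨ M < d
  | d, node R m child => ¬ G.InSingleFace R ∧ d ≤ M ∧
      IsCellSplitting D r c R m (fun i => (child i).cell) ∧
      ∀ i, IsSubtree G D r c M (d + 1) (child i)

/-- The tree is a partition tree for `(G, D)` with parameters `r` and `α`, and with `c` as the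
constant hidden in the bounds of the splitting step. The root, at depth `0`, is a square
that carries the whole distribution, and it is always split; the depth threshold is
`⌊α log_r n⌋`, where `n` is the number of vertices of `G`. -/
def IsPartitionTree (G : PlanarSubdivision) (D : Measure Plane) (r : ℕ) (c α : ℝ) :
    CellTree → Prop
  | leaf _ => False
  | node Q m child => IsClosedSquare Q ∧ D Qᶜ = 0 ∧
      IsCellSplitting D r c Q m (fun i => (child i).cell) ∧
      ∀ i, IsSubtree G D r c ⌊α * Real.logb r G.vertices.card⌋₊ 1 (child i)

end CellTree

/-! ### Triangles -/

/-! The two entropies are compared through the expected leaf depth E under `D`. Upper bound on H(L):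
if nodes have at most B children, Kraft's inequality gives the weights B^(-depth) total at most 1,
and Gibbs' inequality yields H(L) ≤ E log₂ B + O(1) (`partitionEntropy_leaves_le_mul_leafSum`).
Lower bound on H*: fix a triangle t of the Steiner triangulation. A non-root inner cell is not
contained in a face while t is, so if the cell meets t in positive measure, one of the three lines
bounding t crosses its interior. Each splitting lets a line meet at most c√r log r pieces, each with
at most a fraction 3/r of the mass, so for large r the crossed mass, counted with multiplicity,
shrinks by a factor 4 per level. Hence the sum of D(F ∩ t) 2^depth over the leaves F is bounded, and
a Jensen-type estimate bounds the mean depth on t by log₂(1/D(t)) + O(1). Summing over t gives E ≤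
H* + O(1) (`leafSum_measureReal_mul_depth_le`). -/

theorem IsTriangle.isCompact {S : Set Plane} (h : IsTriangle S) : IsCompact S := by
  obtain ⟨x, y, z, -, rfl⟩ := h
  exact (Set.toFinite _).isCompact_convexHull ℝ

theorem IsTriangle.isClosed {S : Set Plane} (h : IsTriangle S) : IsClosed S :=
  h.isCompact.isClosed

theorem IsTriangle.convex {S : Set Plane} (h : IsTriangle S) : Convex ℝ S := by
  obtain ⟨x, y, z, -, rfl⟩ := h
  exact convex_convexHull ℝ _

/-- The boundary of a triangle is contained in the union of three lines. -/
theorem IsTriangle.exists_lines {S : Set Plane} (h : IsTriangle S) :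
    ∃ ℓ : Fin 3 → AffineSubspace ℝ Plane, (∀ j, IsLine (ℓ j)) ∧
      frontier S ⊆ ⋃ j, (ℓ j : Set Plane) := by
  have hc := h.isClosed
  obtain ⟨x, y, z, hi, rfl⟩ := h
  have htop : affineSpan ℝ (Set.range ![x, y, z]) = ⊤ :=
    hi.affineSpan_eq_top_iff_card_eq_finrank_add_one.2 (by simp)
  let b : AffineBasis (Fin 3) ℝ Plane := ⟨![x, y, z], hi, htop⟩
  have hr : ({x, y, z} : Set Plane) = Set.range b := by
    have hb : (b : Fin 3 → Plane) = ![x, y, z] := rfl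
    rw [hb]
    ext p
    simp only [Matrix.range_cons, Matrix.range_empty, Set.union_empty, Set.singleton_union]
  have hline : ∀ j k : Fin 3, j ≠ k → IsLine (line[ℝ, b j, b k]) := by
    intro j k hjk
    have hne : b j ≠ b k := fun e => hjk (b.ind.injective e)
    rw [IsLine, direction_affineSpan, vectorSpan_pair]
    exact finrank_span_singleton (vsub_ne_zero.2 hne)
  refine ⟨![line[ℝ, b 1, b 2], line[ℝ, b 0, b 2], line[ℝ, b 0, b 1]], ?_, ?_⟩
  · intro j
    fin_cases j
    · exact hline 1 2 (by decide)
    · exact hline 0 2 (by decide)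
    · exact hline 0 1 (by decide)
  · intro p hp
    rw [hc.frontier_eq, hr] at hp
    obtain ⟨hp1, hp2⟩ := hp
    rw [b.interior_convexHull] at hp2
    rw [b.convexHull_eq_nonneg_coord] at hp1
    simp only [Set.mem_ofPred_eq, not_forall, not_lt] at hp1 hp2
    -- A boundary point has a vanishing barycentric coordinate, so it lies on the line through the
    -- other two vertices.
    obtain ⟨j, hj⟩ := hp2
    have h0 : b.coord j p = 0 := le_antisymm hj (hp1 j)
    have hsum := b.sum_coord_apply_eq_one p
    have hlin := b.linear_combination_coord_eq_self p
    have key : ∀ u v : Plane, ∀ s t : ℝ, s + t = 1 → p = s • u + t • v → p ∈ line[ℝ, u, v] := by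
      intro u v s t hst hpe
      have : p = AffineMap.lineMap u v t := by
        rw [hpe, AffineMap.lineMap_apply_module, ← hst]
        simp
      rw [this]
      exact AffineMap.lineMap_mem_affineSpan_pair t u v
    rw [Fin.sum_univ_three] at hsum hlin
    refine Set.mem_iUnion.2 ⟨j, ?_⟩
    fin_cases j
    · simp only [Fin.zero_eta] at h0
      rw [h0, zero_add] at hsum
      rw [h0, zero_smul, zero_add] at hlin
      exact key _ _ _ _ hsum hlin.symm
    · simp only [Fin.mk_one] at h0
      rw [h0, add_zero] at hsum
      rw [h0, zero_smul, add_zero] at hlin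
      exact key _ _ _ _ hsum hlin.symm
    · simp only [Fin.reduceFinMk] at h0
      rw [h0, add_zero] at hsum
      rw [h0, zero_smul, add_zero] at hlin
      exact key _ _ _ _ hsum hlin.symm

/-! ### Tilings up to null sets -/

theorem frontier_iUnion_subset_of_finite {X ι : Type*} [TopologicalSpace X] [Finite ι]
    (A : ι → Set X) : frontier (⋃ i, A i) ⊆ ⋃ i, frontier (A i) := by
  intro x hx
  rw [frontier, closure_iUnion_of_finite] at hx
  obtain ⟨h1, h2⟩ := hx
  obtain ⟨i, hi⟩ := Set.mem_iUnion.1 h1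
  exact Set.mem_iUnion.2 ⟨i, hi, fun h => h2 (interior_mono (Set.subset_iUnion A i) h)⟩

theorem measure_frontier_iUnion_of_finite {X ι : Type*} [TopologicalSpace X] [MeasurableSpace X]
    [Finite ι] {μ : Measure X} {A : ι → Set X} (h : ∀ i, μ (frontier (A i)) = 0) :
    μ (frontier (⋃ i, A i)) = 0 :=
  measure_mono_null (frontier_iUnion_subset_of_finite A) (measure_iUnion_null h)

theorem measure_interior_eq_of_null_frontier {X : Type*} [TopologicalSpace X] [MeasurableSpace X]
    {μ : Measure X} {A : Set X} (h : μ (frontier A) = 0) : μ (interior A) = μ A :=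
  measure_congr (interior_ae_eq_of_null_frontier h)

/-- Closed sets with null boundaries and disjoint interiors have additive measure. -/
theorem sum_measureReal_inter_eq {ι : Type*} [Fintype ι] {D : Measure Plane}
    [IsFiniteMeasure D] {A : ι → Set Plane} (hc : ∀ i, IsClosed (A i))
    (hd : ∀ i j, i ≠ j → Disjoint (interior (A i)) (interior (A j)))
    (hf : ∀ i, D (frontier (A i)) = 0) (S : Set Plane) :
    ∑ i, D.real (A i ∩ S) = D.real ((⋃ i, A i) ∩ S) := by
  have hm : ∀ i, MeasurableSet (A i) := fun i => (hc i).measurableSet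
  -- Restricting the measure to `S` instead of intersecting the sets allows `S` to be
  -- non-measurable.
  have hdis : Pairwise (Function.onFun (AEDisjoint (D.restrict S)) A) := by
    intro i j hij
    refine measure_mono_null (t := frontier (A i) ∪ frontier (A j)) ?_ ?_
    · rintro x ⟨h1, h2⟩
      by_contra hx
      rw [Set.mem_union, not_or, (hc i).frontier_eq, (hc j).frontier_eq] at hx
      have a1 : x ∈ interior (A i) := by
        by_contra h
        exact hx.1 ⟨h1, h⟩
      have a2 : x ∈ interior (A j) := by
        by_contra h
        exact hx.2 ⟨h2, h⟩
      exact Set.disjoint_left.1 (hd i j hij) a1 a2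
    · exact Measure.absolutelyContinuous_of_le Measure.restrict_le_self
        (measure_union_null (hf i) (hf j))
  have := measure_iUnion₀ hdis (fun i => (hm i).nullMeasurableSet)
  rw [Measure.restrict_apply (MeasurableSet.iUnion hm), tsum_fintype] at this
  simp only [Measure.restrict_apply (hm _)] at this
  simp only [Measure.real]
  rw [this, ENNReal.toReal_sum (fun i _ => measure_ne_top _ _)]

namespace IsCellSplitting

variable {D : Measure Plane} {r : ℕ} {c : ℝ} {R : Set Plane} {m : ℕ} {A : Fin m → Set Plane}

theorem sum_measureReal_inter [IsFiniteMeasure D] (h : IsCellSplitting D r c R m A)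
    (hf : ∀ i, D (frontier (A i)) = 0) (S : Set Plane) :
    ∑ i, D.real (A i ∩ S) = D.real (R ∩ S) := by
  rw [sum_measureReal_inter_eq (fun i => (h.tiling.1 i).isClosed) h.tiling.2 hf, h.union_eq]

theorem subset (h : IsCellSplitting D r c R m A) (i : Fin m) : A i ⊆ R :=
  h.union_eq ▸ Set.subset_iUnion A i

/-- Every piece of a cell has a small fraction of the measure of the cell. -/
theorem measureReal_le [IsFiniteMeasure D] (h : IsCellSplitting D r c R m A)
    (hf : ∀ i, D (frontier (A i)) = 0) (i : Fin m) :
    D.real (A i) ≤ 3 / r * D.real R := by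
  by_cases hR : D R = 0
  · have : D (A i) = 0 := measure_mono_null (h.subset i) hR
    simp [Measure.real, this, hR]
  have hRm : MeasurableSet R :=
    h.union_eq ▸ MeasurableSet.iUnion fun i => (h.tiling.1 i).isClosed.measurableSet
  obtain ⟨Δ, hΔ, hdis⟩ := h.refines
  have hcond : (ProbabilityTheory.cond D R).real (interior (A i)) ≤ 3 / r := by
    -- The interior of the piece is connected and avoids the boundary of `Δ j`.
    have hdich : ∀ j, interior (A i) ⊆ interior (Δ j) ∨ Disjoint (interior (A i)) (Δ j) := by
      intro j
      by_cases hn : (interior (A i) ∩ interior (Δ j)).Nonempty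
      · left
        refine (h.tiling.1 i).convex.interior.isPreconnected.subset_left_of_subset_union
          isOpen_interior (hΔ.triangle j).isClosed.isOpen_compl ?_ ?_ hn
        · exact Set.disjoint_compl_right_iff_subset.2 interior_subset
        · intro x hx
          by_contra hx'
          rw [Set.mem_union, not_or, Set.notMem_compl_iff] at hx'
          refine Set.disjoint_left.1 (hdis i j) hx ?_
          rw [(hΔ.triangle j).isClosed.frontier_eq]
          exact ⟨hx'.2, hx'.1⟩
      · right
        rw [Set.disjoint_left]
        intro x hx hx'
        refine Set.disjoint_left.1 (hdis i j) hx ?_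
        rw [(hΔ.triangle j).isClosed.frontier_eq]
        exact ⟨hx', fun h' => hn ⟨x, hx, h'⟩⟩
    by_cases hex : ∃ j, interior (A i) ⊆ Δ j
    -- For the least index `j` whose triangle contains the interior of the piece, all earlier
    -- triangles miss it, so `small` applies.
    · have hmin := WellFounded.min_mem (wellFounded_lt (α := Fin r))
        {j | interior (A i) ⊆ Δ j} hex
      set j := WellFounded.min (wellFounded_lt (α := Fin r)) {j | interior (A i) ⊆ Δ j} hex
      refine (measureReal_mono ?_).trans (hΔ.small j)
      intro x hx
      refine ⟨hmin hx, fun hx' => ?_⟩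
      simp only [Set.mem_iUnion] at hx'
      obtain ⟨k, hk, hxk⟩ := hx'
      rcases hdich k with h1 | h1
      · exact WellFounded.not_lt_min (wellFounded_lt (α := Fin r)) {j | interior (A i) ⊆ Δ j}
          (h1.trans interior_subset) hk
      · exact Set.disjoint_left.1 h1 hx hxk
    · push Not at hex
      have : (ProbabilityTheory.cond D R) (interior (A i)) = 0 := by
        refine measure_mono_null (t := (⋃ i, Δ i)ᶜ) (fun x hx hx' => ?_) hΔ.cover
        obtain ⟨k, hk⟩ := Set.mem_iUnion.1 hx'
        rcases hdich k with h1 | h1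
        · exact hex k (h1.trans interior_subset)
        · exact Set.disjoint_left.1 h1 hx hk
      rw [Measure.real, this]
      simp only [ENNReal.toReal_zero]
      positivity
  have hint : D.real (A i) = D.real (interior (A i)) := by
    simp only [Measure.real, measure_interior_eq_of_null_frontier (hf i)]
  have hpos : 0 < D.real R := ENNReal.toReal_pos hR (measure_ne_top _ _)
  rw [Measure.real, ProbabilityTheory.cond_apply hRm, ENNReal.toReal_mul, ENNReal.toReal_inv,
    ← Measure.real, ← Measure.real, Set.inter_eq_right.2 (interior_subset.trans (h.subset i)), ← hint] at hcond
  rwa [inv_mul_le_iff₀ hpos, mul_comm] at hcond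

end IsCellSplitting

/-! ### The number of crossing lines -/

open Classical in
/-- The number of lines of the family that meet the interior of `R`. -/
noncomputable def crossNumber (ℓ : Fin 3 → AffineSubspace ℝ Plane) (R : Set Plane) : ℝ :=
  ∑ j, if ((ℓ j : Set Plane) ∩ interior R).Nonempty then 1 else 0

theorem crossNumber_nonneg (ℓ : Fin 3 → AffineSubspace ℝ Plane) (R : Set Plane) :
    0 ≤ crossNumber ℓ R :=
  Finset.sum_nonneg fun _ _ => by split_ifs <;> norm_num

theorem crossNumber_le_three (ℓ : Fin 3 → AffineSubspace ℝ Plane) (R : Set Plane) :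
    crossNumber ℓ R ≤ 3 := by
  refine (Finset.sum_le_card_nsmul Finset.univ _ 1 fun _ _ => ?_).trans (by simp)
  split_ifs <;> norm_num

theorem one_le_crossNumber {ℓ : Fin 3 → AffineSubspace ℝ Plane} {R : Set Plane} (j : Fin 3)
    (h : ((ℓ j : Set Plane) ∩ interior R).Nonempty) : 1 ≤ crossNumber ℓ R := by
  classical
  have := Finset.single_le_sum (s := Finset.univ)
    (f := fun j => if ((ℓ j : Set Plane) ∩ interior R).Nonempty then (1 : ℝ) else 0)
    (fun _ _ => by split_ifs <;> norm_num) (Finset.mem_univ j)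
  simpa [crossNumber, h] using this

/-- Only lines that already cross `R` can cross its pieces, and each of them crosses at most `c * √r
* Real.log r`. -/
theorem IsCellSplitting.sum_crossNumber_le {D : Measure Plane} {r : ℕ} {c : ℝ} {R : Set Plane}
    {m : ℕ} {A : Fin m → Set Plane} (h : IsCellSplitting D r c R m A)
    {ℓ : Fin 3 → AffineSubspace ℝ Plane} (hℓ : ∀ j, IsLine (ℓ j)) :
    ∑ i, crossNumber ℓ (A i) ≤ crossNumber ℓ R * (c * √r * Real.log r) := by
  classical
  simp only [crossNumber]
  rw [Finset.sum_comm, Finset.sum_mul]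
  refine Finset.sum_le_sum fun j _ => ?_
  split_ifs with hj
  · refine le_trans (le_of_eq ?_) ((h.crossing (ℓ j) (hℓ j)).trans_eq (one_mul _).symm)
    rw [Finset.sum_boole, Set.ncard_eq_toFinset_card']
    congr 2
    ext i
    simp
  · rw [zero_mul]
    refine (Finset.sum_eq_zero fun i _ => if_neg fun h' => hj ?_).le
    exact h'.mono (Set.inter_subset_inter_right _ (interior_mono (h.subset i)))

/-- A convex cell that is not contained in a face, but meets a triangle that is, is crossed by the
boundary of the triangle. -/
theorem measureReal_inter_le_crossNumber_mul {G : PlanarSubdivision} {D : Measure Plane}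
    [IsFiniteMeasure D] {R t : Set Plane} (hR : IsTriangle R) (ht : IsTriangle t)
    (hRG : ¬ G.InSingleFace R) (htG : G.InSingleFace t)
    (hRf : D (frontier R) = 0) (htf : D (frontier t) = 0)
    {ℓ : Fin 3 → AffineSubspace ℝ Plane} (hℓ : frontier t ⊆ ⋃ j, (ℓ j : Set Plane)) :
    D.real (R ∩ t) ≤ crossNumber ℓ R * D.real R := by
  by_cases h0 : D (R ∩ t) = 0
  · rw [Measure.real, h0]
    exact mul_nonneg (crossNumber_nonneg _ _) measureReal_nonneg
  have hmeet : (interior R ∩ interior t).Nonempty := by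
    rw [Set.nonempty_iff_ne_empty]
    intro he
    refine h0 (measure_mono_null (t := frontier R ∪ frontier t) ?_ (measure_union_null hRf htf))
    rintro x ⟨h1, h2⟩
    rw [hR.isClosed.frontier_eq, ht.isClosed.frontier_eq]
    by_cases hx : x ∈ interior R
    · exact Or.inr ⟨h2, fun h' => Set.notMem_empty x (he ▸ ⟨hx, h'⟩)⟩
    · exact Or.inl ⟨h1, hx⟩
  have hnot : ¬ interior R ⊆ interior t := by
    intro hsub
    obtain ⟨f, hf, hft⟩ := htG
    exact hRG ⟨f, hf, hsub.trans hft⟩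
  -- A connected set that meets the interior of `t` without being contained in it must meet the
  -- boundary.
  have hcross : (interior R ∩ frontier t).Nonempty := by
    by_contra hne
    refine hnot (hR.convex.interior.isPreconnected.subset_left_of_subset_union
      isOpen_interior ht.isClosed.isOpen_compl
      (Set.disjoint_compl_right_iff_subset.2 interior_subset) ?_ hmeet)
    intro x hx
    by_contra hx'
    rw [Set.mem_union, not_or, Set.notMem_compl_iff] at hx'
    refine hne ⟨x, hx, ?_⟩
    rw [ht.isClosed.frontier_eq]
    exact ⟨hx'.2, hx'.1⟩
  obtain ⟨x, hxR, hxt⟩ := hcross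
  obtain ⟨j, hj⟩ := Set.mem_iUnion.1 (hℓ hxt)
  calc D.real (R ∩ t) ≤ 1 * D.real R := by
        rw [one_mul]; exact measureReal_mono Set.inter_subset_left
    _ ≤ _ := mul_le_mul_of_nonneg_right (one_le_crossNumber j ⟨x, hj, hxR⟩) measureReal_nonneg

/-! ### Sums over the leaves of a tree -/

namespace CellTree

/-- The sum of `f (depth of F) F` over all leaf nodes `F` (with multiplicity), where the root
has depth `d`. -/
noncomputable def leafSum (f : ℕ → Set Plane → ℝ) : ℕ → CellTree → ℝ
  | d, leaf F => f d F
  | d, node _ _ child => ∑ i, leafSum f (d + 1) (child i)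

theorem leafSum_le_leafSum {f g : ℕ → Set Plane → ℝ} (h : ∀ d F, f d F ≤ g d F) (d : ℕ)
    (T : CellTree) : leafSum f d T ≤ leafSum g d T := by
  induction T generalizing d with
  | leaf F => exact h d F
  | node R m child ih => exact Finset.sum_le_sum fun i _ => ih i (d + 1)

theorem leafSum_add (f g : ℕ → Set Plane → ℝ) (d : ℕ) (T : CellTree) :
    leafSum (fun d F => f d F + g d F) d T = leafSum f d T + leafSum g d T := by
  induction T generalizing d with
  | leaf F => rfl
  | node R m child ih => simp only [leafSum, ih, Finset.sum_add_distrib]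

theorem leafSum_const_mul (a : ℝ) (f : ℕ → Set Plane → ℝ) (d : ℕ) (T : CellTree) :
    leafSum (fun d F => a * f d F) d T = a * leafSum f d T := by
  induction T generalizing d with
  | leaf F => rfl
  | node R m child ih => simp only [leafSum, ih, Finset.mul_sum]

theorem leafSum_finset_sum {ι : Type*} (s : Finset ι) (f : ι → ℕ → Set Plane → ℝ) (d : ℕ)
    (T : CellTree) :
    leafSum (fun d F => ∑ t ∈ s, f t d F) d T = ∑ t ∈ s, leafSum (f t) d T := by
  induction T generalizing d with
  | leaf F => rfl
  | node R m child ih =>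
    simp only [leafSum, ih]
    exact Finset.sum_comm

/-- Every inner node is divided by a cell splitting. -/
def IsSplittingTree (D : Measure Plane) (r : ℕ) (c : ℝ) : CellTree → Prop
  | leaf _ => True
  | node R m child => IsCellSplitting D r c R m (fun i => (child i).cell) ∧
      ∀ i, IsSplittingTree D r c (child i)

theorem IsSubtree.isSplittingTree {G : PlanarSubdivision} {D : Measure Plane} {r : ℕ} {c : ℝ}
    {M d : ℕ} {T : CellTree} (h : IsSubtree G D r c M d T) : IsSplittingTree D r c T := by
  induction T generalizing d with
  | leaf F => trivial
  | node R m child ih => exact ⟨h.2.2.1, fun i => ih i (h.2.2.2 i)⟩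

theorem IsPartitionTree.isSplittingTree {G : PlanarSubdivision} {D : Measure Plane} {r : ℕ}
    {c α : ℝ} {T : CellTree} (h : IsPartitionTree G D r c α T) : IsSplittingTree D r c T := by
  cases T with
  | leaf F => trivial
  | node R m child => exact ⟨h.2.2.1, fun i => (h.2.2.2 i).isSplittingTree⟩

theorem leaves_child_subset {R : Set Plane} {m : ℕ} {child : Fin m → CellTree} (i : Fin m) :
    (child i).leaves ⊆ (node R m child).leaves := by
  classical
  exact Finset.subset_biUnion_of_mem (fun i => (child i).leaves) (Finset.mem_univ i)

section

variable {D : Measure Plane} {r : ℕ} {c : ℝ}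

/-- Every cell is a finite union of the leaves below it, so null leaf boundaries propagate up the
tree. -/
theorem IsSplittingTree.measure_frontier_cell {T : CellTree} (h : IsSplittingTree D r c T)
    (hf : ∀ F ∈ T.leaves, D (frontier F) = 0) : D (frontier T.cell) = 0 := by
  induction T with
  | leaf F => exact hf F (by simp [leaves])
  | node R m child ih =>
    rw [cell, ← h.1.union_eq]
    exact measure_frontier_iUnion_of_finite fun i =>
      ih i (h.2 i) fun F hF => hf F (leaves_child_subset i hF)

theorem IsSplittingTree.leafSum_measureReal_inter [IsFiniteMeasure D] {T : CellTree}
    (h : IsSplittingTree D r c T) (hf : ∀ F ∈ T.leaves, D (frontier F) = 0) (S : Set Plane)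
    (d : ℕ) : leafSum (fun _ F => D.real (F ∩ S)) d T = D.real (T.cell ∩ S) := by
  induction T generalizing d with
  | leaf F => rfl
  | node R m child ih =>
    have hf' : ∀ i, ∀ F ∈ (child i).leaves, D (frontier F) = 0 :=
      fun i F hF => hf F (leaves_child_subset i hF)
    simp only [leafSum]
    rw [Finset.sum_congr rfl fun i _ => ih i (h.2 i) (hf' i) (d + 1)]
    exact h.1.sum_measureReal_inter (fun i => (h.2 i).measure_frontier_cell (hf' i)) S

/-- Kraft's inequality. -/
theorem IsSplittingTree.leafSum_inv_pow_le {T : CellTree} (h : IsSplittingTree D r c T) {B : ℝ}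
    (hB : 0 < B) (hcB : c * (r : ℝ) ^ 2 ≤ B) (d : ℕ) :
    leafSum (fun d _ => (B ^ d)⁻¹) d T ≤ (B ^ d)⁻¹ := by
  induction T generalizing d with
  | leaf F => exact le_rfl
  | node R m child ih =>
    calc ∑ i, leafSum (fun d _ => (B ^ d)⁻¹) (d + 1) (child i)
        ≤ ∑ _i : Fin m, (B ^ (d + 1))⁻¹ := Finset.sum_le_sum fun i _ => ih i (h.2 i) (d + 1)
      _ = m * (B ^ (d + 1))⁻¹ := by simp
      _ ≤ B * (B ^ (d + 1))⁻¹ := by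
        gcongr
        exact h.1.card_le.trans hcB
      _ = (B ^ d)⁻¹ := by
        rw [pow_succ]
        field_simp

theorem mul_logb_inv_nonneg [IsProbabilityMeasure D] (F : Set Plane) :
    0 ≤ D.real F * Real.logb 2 (1 / D.real F) := by
  refine mul_nonneg measureReal_nonneg ?_
  rcases measureReal_nonneg.eq_or_lt' (a := D.real F) with h | h
  · simp [h]
  · refine Real.logb_nonneg (by norm_num) ?_
    rw [le_div_iff₀ h, one_mul]
    exact measureReal_le_one

theorem _root_.Finset.sum_biUnion_le_sum_sum {ι β : Type*} [DecidableEq β] {f : β → ℝ}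
    (hf : ∀ x, 0 ≤ f x) (s : Finset ι) (t : ι → Finset β) :
    ∑ x ∈ s.biUnion t, f x ≤ ∑ i ∈ s, ∑ x ∈ t i, f x := by
  classical
  induction s using Finset.induction_on with
  | empty => simp
  | insert a s ha ih =>
    rw [Finset.biUnion_insert, Finset.sum_insert ha]
    have h1 := Finset.sum_union_inter (s₁ := t a) (s₂ := s.biUnion t) (f := f)
    have h2 : 0 ≤ ∑ x ∈ t a ∩ s.biUnion t, f x := Finset.sum_nonneg fun x _ => hf x
    linarith

/-- `leaves` merges nodes with equal cells, while `leafSum` counts each node. The entropy terms are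
nonnegative, so merging can only decrease the sum. -/
theorem partitionEntropy_leaves_le [IsProbabilityMeasure D] (d : ℕ) (T : CellTree) :
    partitionEntropy D T.leaves ≤
      leafSum (fun _ F => D.real F * Real.logb 2 (1 / D.real F)) d T := by
  classical
  induction T generalizing d with
  | leaf F => simp [partitionEntropy, leaves, leafSum]
  | node R m child ih =>
    refine le_trans ?_ (Finset.sum_le_sum fun i _ => ih i (d + 1))
    exact Finset.sum_biUnion_le_sum_sum mul_logb_inv_nonneg _ _

/-! ### The exponential moment of the leaf depth -/

/-- Leaves at large depth contribute little to a triangle inside a face. -/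
theorem IsSubtree.leafSum_measureReal_inter_mul_two_pow_le [IsFiniteMeasure D]
    {G : PlanarSubdivision} {M d : ℕ} {T : CellTree} (h : IsSubtree G D r c M d T)
    (hT : IsTriangle T.cell) (hf : ∀ F ∈ T.leaves, D (frontier F) = 0)
    (hr : 3 / (r : ℝ) * (c * √r * Real.log r) ≤ 1 / 4)
    {t : Set Plane} (ht : IsTriangle t) (htG : G.InSingleFace t) (htf : D (frontier t) = 0)
    {ℓ : Fin 3 → AffineSubspace ℝ Plane} (hℓ : ∀ j, IsLine (ℓ j))
    (htℓ : frontier t ⊆ ⋃ j, (ℓ j : Set Plane)) :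
    leafSum (fun d F => D.real (F ∩ t) * 2 ^ d) d T ≤
      2 ^ d * (D.real (T.cell ∩ t) + 4 * (crossNumber ℓ T.cell * D.real T.cell)) := by
  induction T generalizing d with
  | leaf F =>
    have : 0 ≤ crossNumber ℓ F * D.real F :=
      mul_nonneg (crossNumber_nonneg _ _) measureReal_nonneg
    simp only [leafSum, cell]
    rw [mul_comm]
    gcongr
    linarith
  | node R m child ih =>
    have hRf := h.isSplittingTree.measure_frontier_cell hf
    obtain ⟨hRG, -, hs, hch⟩ := h
    have hf' : ∀ i, ∀ F ∈ (child i).leaves, D (frontier F) = 0 :=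
      fun i F hF => hf F (leaves_child_subset i hF)
    have hcf : ∀ i, D (frontier (child i).cell) = 0 :=
      fun i => (hch i).isSplittingTree.measure_frontier_cell (hf' i)
    simp only [leafSum, cell] at hT hRf ⊢
    -- The potential (crossing number times mass) drops by a factor 4 per level, which outweighs the
    -- doubling of `2 ^ d`.
    have hpot : ∑ i, crossNumber ℓ (child i).cell * D.real (child i).cell ≤
        crossNumber ℓ R * D.real R * (1 / 4) := by
      calc ∑ i, crossNumber ℓ (child i).cell * D.real (child i).cell
          ≤ ∑ i, crossNumber ℓ (child i).cell * (3 / r * D.real R) :=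
            Finset.sum_le_sum fun i _ => mul_le_mul_of_nonneg_left
              (hs.measureReal_le hcf i) (crossNumber_nonneg _ _)
        _ = (∑ i, crossNumber ℓ (child i).cell) * (3 / r * D.real R) := by
            rw [Finset.sum_mul]
        _ ≤ crossNumber ℓ R * (c * √r * Real.log r) * (3 / r * D.real R) :=
            mul_le_mul_of_nonneg_right (hs.sum_crossNumber_le hℓ) (by positivity)
        _ = crossNumber ℓ R * D.real R * (3 / r * (c * √r * Real.log r)) := by ring
        _ ≤ _ := mul_le_mul_of_nonneg_left hr
            (mul_nonneg (crossNumber_nonneg _ _) measureReal_nonneg)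
    have hmeet := measureReal_inter_le_crossNumber_mul hT ht hRG htG hRf htf htℓ
    calc ∑ i, leafSum (fun d F => D.real (F ∩ t) * 2 ^ d) (d + 1) (child i)
        ≤ ∑ i, 2 ^ (d + 1) * (D.real ((child i).cell ∩ t) +
            4 * (crossNumber ℓ (child i).cell * D.real (child i).cell)) :=
          Finset.sum_le_sum fun i _ => ih i (hch i) (hs.tiling.1 i) (hf' i)
      _ = 2 ^ (d + 1) * (D.real (R ∩ t) +
            4 * ∑ i, crossNumber ℓ (child i).cell * D.real (child i).cell) := by
          rw [← Finset.mul_sum, Finset.sum_add_distrib, hs.sum_measureReal_inter hcf,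
            Finset.mul_sum]
      -- With Φ the potential of `R`, `hmeet` gives D(R ∩ t) ≤ Φ, and the children contribute 4 ·
      -- Φ/4. The coefficient 4 is the fixed point of K = 2(1 + K/4), so the bound reproduces
      -- itself.
      _ ≤ 2 ^ (d + 1) * (2 * (crossNumber ℓ R * D.real R)) := by
          gcongr
          linarith
      _ = 2 ^ d * (4 * (crossNumber ℓ R * D.real R)) := by ring
      _ ≤ _ := by
          gcongr
          linarith [measureReal_nonneg (μ := D) (s := R ∩ t)]

/-- The root is a square and is split even when it lies in a face, so the recursive bound is applied
to its children. At depth 1, with at most three crossing lines, it gives 26 = 2(1 + 4 · 3). -/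
theorem IsPartitionTree.leafSum_measureReal_inter_mul_two_pow_le [IsProbabilityMeasure D]
    {G : PlanarSubdivision} {α : ℝ} {T : CellTree} (h : IsPartitionTree G D r c α T)
    (hf : ∀ F ∈ T.leaves, D (frontier F) = 0)
    (hr : 3 / (r : ℝ) * (c * √r * Real.log r) ≤ 1 / 4)
    {t : Set Plane} (ht : IsTriangle t) (htG : G.InSingleFace t) (htf : D (frontier t) = 0) :
    leafSum (fun d F => D.real (F ∩ t) * 2 ^ d) 0 T ≤ 26 := by
  obtain ⟨ℓ, hℓ, htℓ⟩ := ht.exists_lines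
  cases T with
  | leaf F => exact h.elim
  | node R m child =>
    obtain ⟨-, -, hs, hch⟩ := h
    have hf' : ∀ i, ∀ F ∈ (child i).leaves, D (frontier F) = 0 :=
      fun i F hF => hf F (leaves_child_subset i hF)
    have hcf : ∀ i, D (frontier (child i).cell) = 0 :=
      fun i => (hch i).isSplittingTree.measure_frontier_cell (hf' i)
    have hsum : ∑ i, D.real (child i).cell ≤ 1 := by
      have := hs.sum_measureReal_inter hcf Set.univ
      simp only [Set.inter_univ] at this
      exact this ▸ measureReal_le_one
    calc ∑ i, leafSum (fun d F => D.real (F ∩ t) * 2 ^ d) (0 + 1) (child i)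
        ≤ ∑ i, 2 ^ (0 + 1) * (D.real ((child i).cell ∩ t) +
            4 * (crossNumber ℓ (child i).cell * D.real (child i).cell)) :=
          Finset.sum_le_sum fun i _ => (hch i).leafSum_measureReal_inter_mul_two_pow_le
            (hs.tiling.1 i) (hf' i) hr ht htG htf hℓ htℓ
      _ ≤ ∑ i, 2 ^ (0 + 1) * (D.real (child i).cell + 4 * (3 * D.real (child i).cell)) := by
          gcongr with i
          · exact measure_ne_top _ _
          · exact Set.inter_subset_left
          · exact crossNumber_le_three _ _
      _ = 26 * ∑ i, D.real (child i).cell := by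
          rw [Finset.mul_sum]
          refine Finset.sum_congr rfl fun i _ => ?_
          ring
      _ ≤ 26 := by linarith

/-- The expected leaf depth on a triangle inside a face. -/
theorem IsPartitionTree.leafSum_measureReal_inter_mul_depth_le [IsProbabilityMeasure D]
    {G : PlanarSubdivision} {α : ℝ} {T : CellTree} (h : IsPartitionTree G D r c α T)
    (hf : ∀ F ∈ T.leaves, D (frontier F) = 0)
    (hr : 3 / (r : ℝ) * (c * √r * Real.log r) ≤ 1 / 4)
    {t : Set Plane} (ht : IsTriangle t) (htG : G.InSingleFace t) (htf : D (frontier t) = 0) :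
    leafSum (fun d F => D.real (F ∩ t) * d) 0 T ≤
      D.real t * Real.logb 2 (1 / D.real t) +
        (Real.logb 2 26 + 1 / Real.log 2) * D.real t := by
  have hlog2 : 0 < Real.log 2 := Real.log_pos (by norm_num)
  rcases measureReal_nonneg.eq_or_lt' (a := D.real t) with h0 | hpos
  · have hz : ∀ F, D.real (F ∩ t) = 0 := fun F =>
      le_antisymm (h0 ▸ measureReal_mono Set.inter_subset_right) measureReal_nonneg
    have := leafSum_const_mul 0 (fun _ _ => 0) 0 T
    simpa [hz, h0] using this.le
  set y : ℝ := 26 / D.real t with hy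
  have hy0 : 0 < y := by positivity
  have hy1 : 1 ≤ y := by
    rw [hy, le_div_iff₀ hpos]
    linarith [measureReal_le_one (μ := D) (s := t)]
  -- Jensen's inequality in tangent form: log z ≤ z with z = 2^d / y. The choice y = 26 / D(t) makes
  -- the exponential terms sum to at most D(t) / log 2.
  have hpt : ∀ (d : ℕ) (F : Set Plane), D.real (F ∩ t) * d ≤
      Real.logb 2 y * D.real (F ∩ t) +
        1 / (y * Real.log 2) * (D.real (F ∩ t) * 2 ^ d) := by
    intro d F
    have h1 : Real.log ((2 : ℝ) ^ d / y) ≤ 2 ^ d / y :=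
      (Real.log_le_sub_one_of_pos (by positivity)).trans (by linarith)
    rw [Real.log_div (by positivity) hy0.ne', Real.log_pow] at h1
    have h2 : (d : ℝ) ≤ Real.logb 2 y + 1 / (y * Real.log 2) * 2 ^ d := by
      have h3 : Real.logb 2 y + 1 / (y * Real.log 2) * 2 ^ d =
          (Real.log y + 2 ^ d / y) / Real.log 2 := by
        rw [Real.logb]
        field_simp
      rw [h3, le_div_iff₀ hlog2]
      linarith
    calc D.real (F ∩ t) * d
        ≤ D.real (F ∩ t) * (Real.logb 2 y + 1 / (y * Real.log 2) * 2 ^ d) :=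
          mul_le_mul_of_nonneg_left h2 measureReal_nonneg
      _ = _ := by ring
  refine (leafSum_le_leafSum hpt 0 T).trans ?_
  rw [leafSum_add, leafSum_const_mul, leafSum_const_mul,
    h.isSplittingTree.leafSum_measureReal_inter hf]
  have hlog : Real.logb 2 y = Real.logb 2 26 + Real.logb 2 (1 / D.real t) := by
    rw [← Real.logb_mul (by norm_num) (by positivity), hy, mul_one_div]
  calc Real.logb 2 y * D.real (T.cell ∩ t) +
        1 / (y * Real.log 2) * leafSum (fun d F => D.real (F ∩ t) * 2 ^ d) 0 T
      ≤ Real.logb 2 y * D.real t + 1 / (y * Real.log 2) * 26 := by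
        gcongr
        · exact Real.logb_nonneg (by norm_num) hy1
        · exact measure_ne_top _ _
        · exact Set.inter_subset_right
        · exact h.leafSum_measureReal_inter_mul_two_pow_le hf hr ht htG htf
    _ = Real.logb 2 y * D.real t + 1 / Real.log 2 * D.real t := by
        rw [hy]
        field_simp
    _ = _ := by
        rw [hlog]
        ring

/-- The expected leaf depth is bounded by the entropy of a Steiner triangulation. -/
theorem IsPartitionTree.leafSum_measureReal_mul_depth_le [IsProbabilityMeasure D]
    {G : PlanarSubdivision} {α : ℝ} {T : CellTree} (h : IsPartitionTree G D r c α T)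
    (hf : ∀ F ∈ T.leaves, D (frontier F) = 0)
    (hr : 3 / (r : ℝ) * (c * √r * Real.log r) ≤ 1 / 4) (hD : D unitSquareᶜ = 0)
    {Δ : Finset (Set Plane)} (hΔ : G.IsSteinerTriangulation Δ)
    (hΔf : ∀ t ∈ Δ, D (frontier t) = 0) :
    leafSum (fun d F => D.real F * d) 0 T ≤
      partitionEntropy D Δ + (Real.logb 2 26 + 1 / Real.log 2) := by
  obtain ⟨htile, hcover, hface⟩ := hΔ
  -- Only the covering property enters here; disjointness of the triangles is needed for `hsum`.
  have hle : ∀ F, D.real F ≤ ∑ t ∈ Δ, D.real (F ∩ t) := by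
    intro F
    have h1 : D.real F ≤ D.real (unitSquareᶜ ∪ ⋃ t ∈ Δ, F ∩ t) := by
      refine measureReal_mono fun x hx => ?_
      by_cases hxs : x ∈ unitSquare
      · obtain ⟨t, ht, hxt⟩ := Set.mem_iUnion₂.1 (hcover hxs)
        exact Or.inr (Set.mem_iUnion₂.2 ⟨t, ht, hx, hxt⟩)
      · exact Or.inl hxs
    have h2 : D.real unitSquareᶜ = 0 := by rw [Measure.real, hD, ENNReal.toReal_zero]
    have h3 := measureReal_union_le (μ := D) unitSquareᶜ (⋃ t ∈ Δ, F ∩ t)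
    have h4 := measureReal_biUnion_finset_le (μ := D) Δ (fun t => F ∩ t)
    linarith
  have hsum : ∑ t ∈ Δ, D.real t ≤ 1 := by
    have := sum_measureReal_inter_eq (D := D) (fun t : Δ => (htile.1 t).isClosed) htile.2
      (fun t => hΔf t t.2) Set.univ
    simp only [Set.inter_univ] at this
    rw [← Finset.sum_coe_sort, this]
    exact measureReal_le_one
  have hlog26 : 0 ≤ Real.logb 2 26 + 1 / Real.log 2 :=
    add_nonneg (Real.logb_nonneg (by norm_num) (by norm_num))
      (one_div_nonneg.2 (Real.log_nonneg (by norm_num)))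
  calc leafSum (fun d F => D.real F * d) 0 T
      ≤ leafSum (fun d F => ∑ t ∈ Δ, D.real (F ∩ t) * d) 0 T := by
        refine leafSum_le_leafSum (fun d F => ?_) 0 T
        rw [← Finset.sum_mul]
        exact mul_le_mul_of_nonneg_right (hle F) d.cast_nonneg
    _ = ∑ t ∈ Δ, leafSum (fun d F => D.real (F ∩ t) * d) 0 T :=
        leafSum_finset_sum Δ (fun t d F => D.real (F ∩ t) * d) 0 T
    _ ≤ ∑ t ∈ Δ, (D.real t * Real.logb 2 (1 / D.real t) +
          (Real.logb 2 26 + 1 / Real.log 2) * D.real t) :=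
        Finset.sum_le_sum fun t ht => h.leafSum_measureReal_inter_mul_depth_le hf hr
          (htile.1 ⟨t, ht⟩) (hface t ht) (hΔf t ht)
    _ = partitionEntropy D Δ + (Real.logb 2 26 + 1 / Real.log 2) * ∑ t ∈ Δ, D.real t := by
        rw [Finset.sum_add_distrib, ← Finset.mul_sum, partitionEntropy]
    _ ≤ _ := by
        have := mul_le_mul_of_nonneg_left hsum hlog26
        linarith

/-- The entropy of the leaves is at most the expected leaf depth times the logarithm of the
branching number, up to a constant. -/
theorem IsSplittingTree.partitionEntropy_leaves_le_mul_leafSum [IsProbabilityMeasure D]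
    {T : CellTree} (h : IsSplittingTree D r c T) {B : ℝ} (hB : 0 < B)
    (hcB : c * (r : ℝ) ^ 2 ≤ B) :
    partitionEntropy D T.leaves ≤
      Real.logb 2 B * leafSum (fun d F => D.real F * d) 0 T + 1 / Real.log 2 := by
  have hlog2 : 0 < Real.log 2 := Real.log_pos (by norm_num)
  -- Gibbs' inequality term by term, comparing D(F) with the Kraft weight B^(-d) through log z ≤ z
  -- for z = B^(-d) / D(F).
  have hpt : ∀ (d : ℕ) (F : Set Plane), D.real F * Real.logb 2 (1 / D.real F) ≤
      Real.logb 2 B * (D.real F * d) + 1 / Real.log 2 * (B ^ d)⁻¹ := by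
    intro d F
    rcases measureReal_nonneg.eq_or_lt' (a := D.real F) with h0 | hpos
    · rw [h0]
      simp only [zero_mul, mul_zero, zero_add]
      positivity
    set x := D.real F
    have h1 : Real.log ((B ^ d)⁻¹ / x) ≤ (B ^ d)⁻¹ / x :=
      (Real.log_le_sub_one_of_pos (by positivity)).trans (by linarith)
    rw [Real.log_div (by positivity) hpos.ne', Real.log_inv, Real.log_pow,
      le_div_iff₀ hpos] at h1
    have h2 : x * Real.logb 2 (1 / x) = -(x * Real.log x) / Real.log 2 := by
      rw [Real.logb, one_div, Real.log_inv]
      ring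
    have h3 : Real.logb 2 B * (x * d) + 1 / Real.log 2 * (B ^ d)⁻¹ =
        (Real.log B * (x * d) + (B ^ d)⁻¹) / Real.log 2 := by
      rw [Real.logb]
      ring
    rw [h2, h3]
    gcongr
    linarith
  have hkraft := h.leafSum_inv_pow_le hB hcB 0
  rw [pow_zero, inv_one] at hkraft
  refine (partitionEntropy_leaves_le 0 T).trans ((leafSum_le_leafSum hpt 0 T).trans ?_)
  rw [leafSum_add, leafSum_const_mul, leafSum_const_mul]
  have := mul_le_mul_of_nonneg_left hkraft (one_div_nonneg.2 hlog2.le)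
  linarith

end

end CellTree

/-! ### Choice of the constants and conclusion -/

theorem exists_forall_mul_sqrt_mul_log_le (c : ℝ) :
    ∃ r₀ : ℕ, ∀ r : ℕ, r₀ ≤ r → 3 / (r : ℝ) * (c * √r * Real.log r) ≤ 1 / 4 := by
  have h := ((isLittleO_log_rpow_atTop (r := 1 / 2) (by norm_num)).tendsto_div_nhds_zero.comp
    tendsto_natCast_atTop_atTop).const_mul (3 * c)
  rw [mul_zero] at h
  obtain ⟨r₀, hr₀⟩ := Filter.eventually_atTop.1
    ((h.eventually_le_const (show (0 : ℝ) < 1 / 4 by norm_num)).and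
      (Filter.eventually_gt_atTop 0))
  refine ⟨r₀, fun r hr => ?_⟩
  obtain ⟨h1, h2⟩ := hr₀ r hr
  -- The left side equals 3c log r / √r, which tends to 0.
  refine le_trans (le_of_eq ?_) h1
  have h3 : (0 : ℝ) < r := Nat.cast_pos.2 h2
  have h4 : 0 < √(r : ℝ) := Real.sqrt_pos.2 h3
  simp only [Function.comp_apply, ← Real.sqrt_eq_rpow]
  nth_rw 1 [← Real.mul_self_sqrt h3.le]
  field_simp

theorem mainTheorem4 (c : ℝ) (hc : 0 < c) :
    ∃ r₀ : ℕ, ∀ r : ℕ, r₀ ≤ r → ∃ κ : ℝ, 0 < κ ∧ ∃ b : ℝ,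
      ∀ (α : ℝ) (_ : 0 < α)
        (G : PlanarSubdivision) (_ : (G.vertices : Set Plane) ⊆ unitSquare)
        (D : MeasureTheory.Measure Plane) (_ : MeasureTheory.IsProbabilityMeasure D)
        (_ : D unitSquareᶜ = 0)
        (T : CellTree) (_ : T.IsPartitionTree G D r c α)
        (_ : ∀ F ∈ T.leaves, D (frontier F) = 0)
        (Δ : Finset (Set Plane)) (_ : G.IsSteinerTriangulation Δ)
        (_ : ∀ t ∈ Δ, D (frontier t) = 0),
        κ * partitionEntropy D T.leaves - b ≤ partitionEntropy D Δ := by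
  obtain ⟨r₀, hr₀⟩ := exists_forall_mul_sqrt_mul_log_le c
  refine ⟨r₀, fun r hr => ?_⟩
  -- The maximum with 2 keeps `Real.logb 2 B` positive even when `c * r ^ 2` is small.
  set B : ℝ := max 2 (c * (r : ℝ) ^ 2)
  have hB2 : 2 ≤ B := le_max_left _ _
  have hβ : 0 < Real.logb 2 B := Real.logb_pos (by norm_num) (by linarith)
  refine ⟨(Real.logb 2 B)⁻¹, inv_pos.2 hβ,
    Real.logb 2 26 + 1 / Real.log 2 + (Real.logb 2 B)⁻¹ * (1 / Real.log 2), ?_⟩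
  intro α _ G _ D _ hD T hT hTf Δ hΔ hΔf
  have h1 := hT.leafSum_measureReal_mul_depth_le hTf (hr₀ r hr) hD hΔ hΔf
  have h2 := hT.isSplittingTree.partitionEntropy_leaves_le_mul_leafSum (B := B) (by linarith)
    (le_max_right _ _)
  have h3 := mul_le_mul_of_nonneg_left h2 (inv_pos.2 hβ).le
  rw [mul_add, inv_mul_cancel_left₀ hβ.ne'] at h3
  linarith
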